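/- Let $X,Y$ be compact Hausdorff spaces, let $\phi:Y\to X$ be a continuous map, and let $\phi^*:C(X)\to C(Y)$, $f\mapsto f\circ\phi$, be the induced $^*$-homomorphism between the $\mathrm{C}^*$-algebras of continuous complex-valued functions. The following are equivalent: (i) $\phi^*$ has nuclear dimension equal to zero; (ii) $\phi^*$ has real rank zero; (iii) $\phi^*$ factors through a commutative $\mathrm{C}^*$-algebra with nuclear dimension equal to zero, i.e. there are a commutative $\mathrm{C}^*$-algebra $C$ with nuclear dimension equal to zero and $^*$-homomorphisms $\alpha:C(X)\to C$ and $\beta:C\to C(Y)$ with $\phi^*=\beta\circ\alpha$. Here a $^*$-homomorphism $\theta:A\to B$ of $\mathrm{C}^*$-algebras has *nuclear dimension equal to zero* if for every finite set $\mathcal F\subseteq A$ and every $\epsilon>0$ there are a finite-dimensional $\mathrm{C}^*$-algebra $F$ and completely positive contractive maps $\psi:A\to F$ and $\eta:F\to B$ such that $\|\eta(\psi(a))-\theta(a)\|\le\epsilon$ for all $a\in\mathcal F$, and $\eta$ has order zero, i.e. $\eta(a)\eta(b)=0$ for all positive $a,b\in F$ with $ab=0$. A $\mathrm{C}^*$-algebra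 has nuclear dimension equal to zero if its identity map does. A $^*$-homomorphism $\theta:A\to B$ has *real rank zero* if for every nonzero positive element $a\in\theta(A)$ the hereditary $\mathrm{C}^*$-subalgebra $\overline{aBa}$ of $B$ has an approximate unit (not necessarily increasing) consisting of projections. -/

import Mathlib

open scoped CStarAlgebra ComplexOrder

universe u v w

noncomputable section

namespace RRZero

section General

/-- The `*`-subalgebra `aBa = {a * b * a | b ∈ B}` of `B`, for a self-adjoint element `a` of `B`. -/
def cornerSubalgebra {B : Type*} [NonUnitalCStarAlgebra B] (a : B) (ha : IsSelfAdjoint a) :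
    NonUnitalStarSubalgebra ℂ B where
  carrier := {x | ∃ b : B, x = a * b * a}
  zero_mem' := ⟨0, by simp⟩
  add_mem' := by
    rintro _ _ ⟨b, rfl⟩ ⟨c, rfl⟩
    exact ⟨b + c, by simp [mul_add, add_mul]⟩
  mul_mem' := by
    rintro _ _ ⟨b, rfl⟩ ⟨c, rfl⟩
    exact ⟨b * a * (a * c), by simp [mul_assoc]⟩
  smul_mem' := by
    rintro z _ ⟨b, rfl⟩
    exact ⟨z • b, by simp [mul_smul_comm, smul_mul_assoc]⟩
  star_mem' := by
    rintro _ ⟨b, rfl⟩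
    exact ⟨star b, by simp [ha.star_eq, mul_assoc]⟩

/-- The hereditary C*-subalgebra of `B` generated by `a`, that is, the norm closure of `aBa`. -/
def hereditarySubalgebra {B : Type*} [NonUnitalCStarAlgebra B] (a : B) (ha : IsSelfAdjoint a) :
    NonUnitalStarSubalgebra ℂ B :=
  (cornerSubalgebra a ha).topologicalClosure

/-- The C*-subalgebra `D` of `B` has an approximate unit consisting of projections of `D`
(not assumed to be increasing). -/
def HasApproximateUnitOfProjections {B : Type*} [NonUnitalCStarAlgebra B]
    (D : NonUnitalStarSubalgebra ℂ B) : Prop :=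
  ∃ l : Filter D, l.IsApproximateUnit ∧ ∀ᶠ p in l, IsStarProjection p

/-- The inclusion `A ⊆ B` of C*-algebras has real rank zero: for every nonzero positive `a ∈ A`,
the hereditary C*-subalgebra of `B` generated by `a` has an approximate unit of projections. -/
def InclusionHasRealRankZero {B : Type*} [NonUnitalCStarAlgebra B] [PartialOrder B]
    [StarOrderedRing B] (A : NonUnitalStarSubalgebra ℂ B) : Prop :=
  ∀ a ∈ A, ∀ ha : 0 ≤ a, a ≠ 0 →
    HasApproximateUnitOfProjections (hereditarySubalgebra a (IsSelfAdjoint.of_nonneg ha))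

/-- A `*`-homomorphism `θ : A → B` has real rank zero if the inclusion `θ(A) ⊆ B` does. -/
def HasRealRankZero {A B : Type*} [NonUnitalCStarAlgebra A]
    [NonUnitalCStarAlgebra B] [PartialOrder B] [StarOrderedRing B] (θ : A →⋆ₙₐ[ℂ] B) : Prop :=
  InclusionHasRealRankZero (NonUnitalStarAlgHom.range θ)

/-- The property of a completely positive map of being contractive (norm-decreasing). -/
def IsContractive {A B : Type*} [NonUnitalCStarAlgebra A] [PartialOrder A] [StarOrderedRing A]
    [NonUnitalCStarAlgebra B] [PartialOrder B] [StarOrderedRing B] (φ : A →CP B) : Prop :=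
  ∀ a : A, ‖φ a‖ ≤ ‖a‖

/-- The property of a completely positive map of having order zero: it preserves orthogonality of
positive elements. -/
def IsOrderZero {A B : Type*} [NonUnitalCStarAlgebra A] [PartialOrder A] [StarOrderedRing A]
    [NonUnitalCStarAlgebra B] [PartialOrder B] [StarOrderedRing B] (φ : A →CP B) : Prop :=
  ∀ a b : A, 0 ≤ a → 0 ≤ b → a * b = 0 → φ a * φ b = 0

/-- A `*`-homomorphism `θ : A → B` has nuclear dimension equal to zero: on finite sets it is
approximated by compositions of a completely positive contraction into a finite-dimensional
C*-algebra `F` and a completely positive contraction of order zero from `F` to `B`.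
(Finite-dimensional C*-algebras are unital and, up to isomorphism, live in the universe `0`; the
zero algebra is allowed.) -/
def HasNuclearDimensionZero {A B : Type*} [NonUnitalCStarAlgebra A] [PartialOrder A]
    [StarOrderedRing A] [NonUnitalCStarAlgebra B] [PartialOrder B] [StarOrderedRing B]
    (θ : A →⋆ₙₐ[ℂ] B) : Prop :=
  ∀ (S : Finset A) (ε : ℝ), 0 < ε →
    ∃ (F : Type) (_ : CStarAlgebra F) (_ : PartialOrder F) (_ : StarOrderedRing F)
      (_ : FiniteDimensional ℂ F) (ψ : A →CP F) (η : F →CP B),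
      IsContractive ψ ∧ IsContractive η ∧ IsOrderZero η ∧ ∀ a ∈ S, ‖η (ψ a) - θ a‖ ≤ ε

/-- A C*-algebra has nuclear dimension equal to zero if its identity map does. -/
def AlgebraHasNuclearDimensionZero (A : Type*) [NonUnitalCStarAlgebra A] [PartialOrder A]
    [StarOrderedRing A] : Prop :=
  HasNuclearDimensionZero (NonUnitalStarAlgHom.id ℂ A)

end General

section Commutative

/-- The `*`-homomorphism `φ^* : C(X) → C(Y)`, `f ↦ f ∘ φ`, induced by `φ : Y → X`. -/
def pullback {X Y : Type*} [TopologicalSpace X] [TopologicalSpace Y] (φ : C(Y, X)) :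
    C(X, ℂ) →⋆ₙₐ[ℂ] C(Y, ℂ) :=
  (ContinuousMap.compStarAlgHom' ℂ ℂ φ).toNonUnitalStarAlgHom

end Commutative

end RRZero

end

namespace RRZero

open Topology Filter

/-! ### Permanence of nuclear dimension zero; profinite spaces -/

section NuclearDimension

/-! Each condition says that `φ` is constant on connected components, i.e. factors through the
profinite space of components of `Y`, whose function algebra has nuclear dimension zero.

(i) ⇒ (ii): evaluated at a point, an order zero map `η` on a finite-dimensional algebra sees only
one spectral projection of `ψ f` (`IsOrderZero.exists_mem_spectrum`). So `η (ψ f) / η 1` is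
continuous with finitely many values, and its level sets are clopen sets separating `{f ∘ φ ≥ δ}`
from `{f ∘ φ = 0}`; their indicators form the approximate unit.

(ii) ⇒ (iii): if `φ` separated two points of one component, some pulled-back function would vanish
at one and be `1` at the other. Projections in its hereditary subalgebra vanish at the first point,
hence on the component, so they cannot approximate a unit at the second. -/

/-- Nuclear dimension zero is preserved by composition with `*`-homomorphisms on both sides. -/
theorem HasNuclearDimensionZero.comp {A B C D : Type*}
    [NonUnitalCStarAlgebra A] [PartialOrder A] [StarOrderedRing A]
    [NonUnitalCStarAlgebra B] [PartialOrder B] [StarOrderedRing B]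
    [NonUnitalCStarAlgebra C] [PartialOrder C] [StarOrderedRing C]
    [NonUnitalCStarAlgebra D] [PartialOrder D] [StarOrderedRing D]
    {θ : B →⋆ₙₐ[ℂ] C} (hθ : HasNuclearDimensionZero θ)
    (α : A →⋆ₙₐ[ℂ] B) (β : C →⋆ₙₐ[ℂ] D) :
    HasNuclearDimensionZero (β.comp (θ.comp α)) := by
  classical
  intro S ε hε
  obtain ⟨F, _, _, _, hF, ψ, η, hψ, hη, h0, h⟩ := hθ (S.image α) ε hε
  refine ⟨F, inferInstance, inferInstance, inferInstance, hF,
    { (ψ : B →ₗ[ℂ] F).comp (α : A →ₗ[ℂ] B) with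
      map_cstarMatrix_nonneg' := fun k M hM ↦ ?_ },
    { (β : C →ₗ[ℂ] D).comp (η : F →ₗ[ℂ] C) with
      map_cstarMatrix_nonneg' := fun k M hM ↦ ?_ }, fun a ↦ ?_, fun c ↦ ?_, fun c d hc hd hcd ↦ ?_,
    fun a ha ↦ ?_⟩
  · exact CompletelyPositiveMapClass.map_cstarMatrix_nonneg' ψ k _
      (CompletelyPositiveMapClass.map_cstarMatrix_nonneg' α k M hM)
  · exact CompletelyPositiveMapClass.map_cstarMatrix_nonneg' β k _
      (CompletelyPositiveMapClass.map_cstarMatrix_nonneg' η k M hM)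
  · exact (hψ (α a)).trans (NonUnitalStarAlgHom.norm_apply_le α a)
  · exact (NonUnitalStarAlgHom.norm_apply_le β (η c)).trans (hη c)
  · change β (η c) * β (η d) = 0
    rw [← map_mul, h0 c d hc hd hcd, map_zero]
  · change ‖β (η (ψ (α a))) - β (θ (α a))‖ ≤ ε
    rw [← map_sub]
    exact (NonUnitalStarAlgHom.norm_apply_le β _).trans (h _ (Finset.mem_image_of_mem α ha))

/-- A finite set of continuous functions on a profinite space is approximately constant on the
pieces of a finite clopen partition. -/
theorem algebraHasNuclearDimensionZero_of_totallyDisconnected (Z : Type*) [TopologicalSpace Z]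
    [CompactSpace Z] [T2Space Z] [TotallyDisconnectedSpace Z] :
    AlgebraHasNuclearDimensionZero C(Z, ℂ) := by
  intro S ε hε
  let f : C(Z, S → ℂ) := ⟨fun z s ↦ s.1 z, by fun_prop⟩
  obtain ⟨n, g, h, hg, hgh⟩ := f.exists_finite_approximation_of_mem_nhds_diagonal
    (S := {p | dist p.1 p.2 < ε / 2})
    (nhdsSet_diagonal_le_uniformity (Metric.dist_mem_uniformity (half_pos hε)))
  have : Fintype (Set.range g) := Fintype.ofFinite _
  -- One sample point per fibre of `g`: `ψ` evaluates at the samples, `η` spreads each value over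
  -- its fibre.
  choose z hz using fun i : Set.range g ↦ i.2
  let ψ : C(Z, ℂ) →⋆ₙₐ[ℂ] (Set.range g → ℂ) :=
    { toFun := fun a i ↦ a (z i)
      map_smul' := fun _ _ ↦ rfl
      map_zero' := rfl
      map_add' := fun _ _ ↦ rfl
      map_mul' := fun _ _ ↦ rfl
      map_star' := fun _ ↦ rfl }
  let η : (Set.range g → ℂ) →⋆ₙₐ[ℂ] C(Z, ℂ) :=
    { toFun := fun c ↦ ⟨fun x ↦ c ⟨g x, x, rfl⟩,
        (continuous_of_discreteTopology (f := c)).comp (hg.subtype_mk _)⟩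
      map_smul' := fun _ _ ↦ rfl
      map_zero' := rfl
      map_add' := fun _ _ ↦ rfl
      map_mul' := fun _ _ ↦ rfl
      map_star' := fun _ ↦ rfl }
  refine ⟨Set.range g → ℂ, inferInstance, inferInstance, inferInstance, inferInstance, ψ, η,
    fun a ↦ NonUnitalStarAlgHom.norm_apply_le ψ a, fun a ↦ NonUnitalStarAlgHom.norm_apply_le η a,
    fun a b _ _ hab ↦ ?_, fun a ha ↦ ?_⟩
  · change η a * η b = 0
    rw [← map_mul, hab, map_zero]
  · refine (ContinuousMap.norm_le _ hε.le).2 fun x ↦ ?_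
    change ‖a (z ⟨g x, x, rfl⟩) - a x‖ ≤ ε
    have hzx : g (z ⟨g x, x, rfl⟩) = g x := hz ⟨g x, x, rfl⟩
    have key : ∀ y, dist (a y) (h (g y) ⟨a, ha⟩) < ε / 2 := fun y ↦
      (dist_le_pi_dist (f y) (h (g y)) ⟨a, ha⟩).trans_lt (hgh y)
    have h1 := key x
    have h2 := key (z ⟨g x, x, rfl⟩)
    rw [hzx] at h2
    rw [← dist_eq_norm]
    linarith [dist_triangle_right (a (z ⟨g x, x, rfl⟩)) (a x) (h (g x) ⟨a, ha⟩)]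

end NuclearDimension

/-! ### Order zero maps and clopen separation -/

section OrderZero

theorem finite_spectrum_of_finiteDimensional {𝕜 A : Type*} [Field 𝕜] [Ring A] [Algebra 𝕜 A]
    [FiniteDimensional 𝕜 A] (a : A) : (spectrum 𝕜 a).Finite := by
  have hint : IsIntegral 𝕜 a := Algebra.IsIntegral.isIntegral a
  refine (Polynomial.finite_setOfPred_isRoot (minpoly.ne_zero hint)).subset fun k hk ↦ ?_
  have h := spectrum.subset_polynomial_aeval a (minpoly 𝕜 a) ⟨k, hk, rfl⟩
  rw [minpoly.aeval, spectrum.mem_iff, sub_zero] at h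
  by_contra hne
  exact h ((IsUnit.mk0 _ hne).map (algebraMap 𝕜 A))

variable {Y : Type*} [TopologicalSpace Y] [CompactSpace Y]

/-- Evaluated at a point, an order zero map from a finite-dimensional C*-algebra to `C(Y)` acts on
a self-adjoint element as a multiple of a character of the algebra generated by this element. -/
theorem IsOrderZero.exists_mem_spectrum {F : Type*} [CStarAlgebra F] [PartialOrder F]
    [StarOrderedRing F] [FiniteDimensional ℂ F] {η : F →CP C(Y, ℂ)} (hη : IsOrderZero η)
    {b : F} (hb : IsSelfAdjoint b) {y : Y} (hy : η 1 y ≠ 0) :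
    ∃ t ∈ spectrum ℝ b, η b y = t * η 1 y := by
  classical
  have hfin : (spectrum ℝ b).Finite := by
    have : FiniteDimensional ℝ F := FiniteDimensional.complexToReal F
    exact finite_spectrum_of_finiteDimensional b
  have hcont : ∀ f : ℝ → ℝ, ContinuousOn f (spectrum ℝ b) := fun f ↦ hfin.continuousOn f
  -- The spectral projection of `b` at `t`; the indicator of a point is continuous on the finite
  -- spectrum.
  let e : ℝ → F := fun t ↦ cfc (Pi.single t (1 : ℝ) : ℝ → ℝ) b
  have he : ∀ t, 0 ≤ e t := fun t ↦ cfc_nonneg fun x _ ↦ by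
    by_cases h : x = t <;> simp [h]
  have hmul : ∀ s t, s ≠ t → e s * e t = 0 := fun s t hst ↦ by
    rw [← cfc_mul _ _ b (hcont _) (hcont _), ← cfc_zero ℝ b]
    refine cfc_congr fun x _ ↦ ?_
    by_cases h : x = s <;> simp [Pi.single_apply, h, hst]
  have hsum : ∀ f : ℝ → ℝ, cfc f b = ∑ t ∈ hfin.toFinset, f t • e t := fun f ↦ by
    simp_rw [e, ← cfc_const_mul _ _ b (hcont _)]
    rw [← cfc_sum _ b _ fun _ _ ↦ hcont _]
    refine cfc_congr fun x hx ↦ ?_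
    simp [Pi.single_apply, hx]
  have h1 : η 1 y = ∑ t ∈ hfin.toFinset, η (e t) y := by
    rw [← cfc_one ℝ b, hsum, map_sum, ContinuousMap.sum_apply]
    simp
  obtain ⟨t, ht, hty⟩ : ∃ t ∈ hfin.toFinset, η (e t) y ≠ 0 := by
    by_contra! h
    exact hy (h1.trans (Finset.sum_eq_zero h))
  -- Orthogonality passes through `η`, and `ℂ` has no zero divisors, so only `e t` survives at `y`.
  have hzero : ∀ s, s ≠ t → η (e s) y = 0 := fun s hs ↦ by
    have h := congrArg (fun k : C(Y, ℂ) ↦ k y) (hη _ _ (he s) (he t) (hmul s t hs))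
    exact (mul_eq_zero.1 h).resolve_right hty
  refine ⟨t, by simpa using ht, ?_⟩
  have hb' : η b y = ∑ s ∈ hfin.toFinset, (s : ℂ) * η (e s) y := by
    conv_lhs => rw [← cfc_id ℝ b, hsum, map_sum, ContinuousMap.sum_apply]
    refine Finset.sum_congr rfl fun s _ ↦ ?_
    rw [← Complex.coe_smul, map_smul]
    rfl
  rw [hb', h1, Finset.sum_eq_single_of_mem t ht fun s _ hs ↦ by rw [hzero s hs, mul_zero],
    Finset.sum_eq_single_of_mem t ht fun s _ hs ↦ hzero s hs]

/-- If `φ^*` has nuclear dimension zero, the sets `{f ∘ φ ≥ δ}` and `{f ∘ φ = 0}` are separated by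
a clopen set. -/
theorem HasNuclearDimensionZero.exists_isClopen {X : Type*} [TopologicalSpace X] [CompactSpace X]
    {φ : C(Y, X)} (hφ : HasNuclearDimensionZero (pullback φ)) {f : C(X, ℂ)} (hf : 0 ≤ f)
    {δ : ℝ} (hδ : 0 < δ) :
    ∃ P : Set Y, IsClopen P ∧ (∀ y, δ ≤ ‖f (φ y)‖ → y ∈ P) ∧ ∀ y ∈ P, f (φ y) ≠ 0 := by
  classical
  -- The bound `1 / 2` gives `1 / 2 ≤ η 1 ≤ 1`. With `δ / 8`, the quotient `t` below is at least `7δ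
  -- / 8` where `f ∘ φ ≥ δ` and at most `δ / 4` where `f ∘ φ = 0`, so `δ / 2` separates.
  obtain ⟨ε, hε, hε1, hε2⟩ : ∃ ε : ℝ, 0 < ε ∧ ε ≤ 1 / 2 ∧ ε ≤ δ / 8 :=
    ⟨min (1 / 2) (δ / 8), by positivity, min_le_left _ _, min_le_right _ _⟩
  obtain ⟨F, _, _, _, _, ψ, η, hψ, hη, h0, h⟩ := hφ {f, 1} ε hε
  have hfy : ∀ y, ‖η (ψ f) y - f (φ y)‖ ≤ ε := fun y ↦
    (ContinuousMap.norm_coe_le_norm (η (ψ f) - pullback φ f) y).trans (h f (by simp))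
  have h1y : ∀ y, ‖η (ψ 1) y - 1‖ ≤ ε := fun y ↦
    (ContinuousMap.norm_coe_le_norm (η (ψ 1) - pullback φ 1) y).trans (h 1 (by simp))
  have hψ1 : ψ 1 ≤ 1 := by
    refine (CStarAlgebra.norm_le_one_iff_of_nonneg _ (map_nonneg ψ zero_le_one)).1 ?_
    exact (hψ 1).trans ((ContinuousMap.norm_le _ zero_le_one).2 fun x ↦ by simp)
  have hlow : ∀ y, 1 / 2 ≤ (η 1 y).re := fun y ↦ by
    have hmono : η (ψ 1) y ≤ η 1 y := (OrderHomClass.mono η hψ1 : η (ψ 1) ≤ η 1) y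
    have := (Complex.abs_re_le_norm _).trans (h1y y)
    rw [Complex.sub_re, Complex.one_re, abs_le] at this
    linarith [(Complex.le_def.1 hmono).1]
  have hup : ∀ y, (η 1 y).re ≤ 1 := fun y ↦ by
    refine (Complex.re_le_norm _).trans ((ContinuousMap.norm_coe_le_norm (η 1) y).trans ?_)
    exact (hη 1).trans ((CStarAlgebra.norm_le_one_iff_of_nonneg (1 : F) zero_le_one).2 le_rfl)
  have hsa : IsSelfAdjoint (ψ f) := .of_nonneg (map_nonneg ψ hf)
  have hfin : (spectrum ℝ (ψ f)).Finite := by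
    have : FiniteDimensional ℝ F := FiniteDimensional.complexToReal F
    exact finite_spectrum_of_finiteDimensional _
  have hspec : ∀ y, ∃ t ∈ spectrum ℝ (ψ f), (η (ψ f) y).re = t * (η 1 y).re := fun y ↦ by
    have hne : η 1 y ≠ 0 := fun h ↦ by have := hlow y; norm_num [h] at this
    obtain ⟨t, ht, hty⟩ := h0.exists_mem_spectrum hsa hne
    exact ⟨t, ht, by rw [hty, Complex.re_ofReal_mul]⟩
  choose t ht hty using hspec
  have htc : Continuous t := by
    have : t = fun y ↦ (η (ψ f) y).re / (η 1 y).re := by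
      ext y
      rw [hty, mul_div_cancel_right₀ _ (by linarith [hlow y])]
    rw [this]
    exact (by fun_prop : Continuous fun y ↦ (η (ψ f) y).re).div (by fun_prop)
      fun y ↦ by linarith [hlow y]
  have hre : ∀ y, |(η (ψ f) y).re - (f (φ y)).re| ≤ ε := fun y ↦ by
    rw [← Complex.sub_re]
    exact (Complex.abs_re_le_norm _).trans (hfy y)
  refine ⟨t ⁻¹' Set.Ioi (δ / 2), ⟨?_, isOpen_Ioi.preimage htc⟩, fun y hy ↦ ?_, fun y hy hfy0 ↦ ?_⟩
  -- As `t` has values in a finite set, this open preimage is also the preimage of a finite, hence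
  -- closed, set.
  · have : t ⁻¹' Set.Ioi (δ / 2) = t ⁻¹' (spectrum ℝ (ψ f) ∩ Set.Ioi (δ / 2)) := by
      ext y
      simp [ht y]
    rw [this]
    exact (hfin.inter_of_left _).isClosed.preimage htc
  · have hnn : 0 ≤ f (φ y) := hf (φ y)
    have hnorm : ‖f (φ y)‖ = (f (φ y)).re := by
      conv_rhs => rw [Complex.eq_coe_norm_of_nonneg hnn, Complex.ofReal_re]
    have := abs_le.1 (hre y)
    rw [hty] at this
    change δ / 2 < t y
    by_contra! hle
    nlinarith [hlow y, hup y]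
  · have := abs_le.1 (hre y)
    rw [hty, hfy0, Complex.zero_re] at this
    have hy' : δ / 2 < t y := hy
    nlinarith [hlow y]

end OrderZero

/-! ### Projections in hereditary subalgebras of `C(Y)` -/

section RealRank

variable {Y : Type*} [TopologicalSpace Y]

/-- The indicator function of a clopen set. -/
noncomputable def clopenIndicator {P : Set Y} (hP : IsClopen P) : C(Y, ℂ) :=
  ⟨P.indicator 1, hP.continuous_indicator continuous_one⟩

theorem isStarProjection_clopenIndicator {P : Set Y} (hP : IsClopen P) :
    IsStarProjection (clopenIndicator hP) where
  isIdempotentElem := by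
    ext y
    by_cases h : y ∈ P <;> simp [clopenIndicator, h]
  isSelfAdjoint := by
    ext y
    by_cases h : y ∈ P <;> simp [clopenIndicator, h]

variable [CompactSpace Y]

theorem apply_eq_zero_of_mem_hereditarySubalgebra {a : C(Y, ℂ)} {ha : IsSelfAdjoint a}
    {m : C(Y, ℂ)} (hm : m ∈ hereditarySubalgebra a ha) {y : Y} (hy : a y = 0) : m y = 0 := by
  have hcl : IsClosed {m : C(Y, ℂ) | m y = 0} :=
    isClosed_eq (continuous_eval_const y) continuous_const
  refine closure_minimal ?_ hcl hm
  rintro _ ⟨b, rfl⟩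
  simp [hy]

theorem exists_norm_apply_le_of_mem_hereditarySubalgebra {a : C(Y, ℂ)} {ha : IsSelfAdjoint a}
    {m : C(Y, ℂ)} (hm : m ∈ hereditarySubalgebra a ha) {ε : ℝ} (hε : 0 < ε) :
    ∃ δ > 0, ∀ y, ‖a y‖ < δ → ‖m y‖ ≤ ε := by
  obtain ⟨_, ⟨b, rfl⟩, hb⟩ := Metric.mem_closure_iff.1 hm (ε / 2) (half_pos hε)
  refine ⟨ε / 2 / (‖a * b‖ + 1), by positivity, fun y hy ↦ ?_⟩
  have h1 : ‖m y - (a * b * a) y‖ ≤ ε / 2 :=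
    (ContinuousMap.norm_coe_le_norm (m - a * b * a) y).trans (by rw [← dist_eq_norm]; exact hb.le)
  have h2 : ‖(a * b * a) y‖ ≤ ε / 2 := by
    rw [ContinuousMap.mul_apply, norm_mul]
    rw [lt_div_iff₀ (by positivity)] at hy
    nlinarith [ContinuousMap.norm_coe_le_norm (a * b) y, norm_nonneg (a y)]
  have h3 := norm_sub_norm_le (m y) ((a * b * a) y)
  linarith

theorem clopenIndicator_mem_hereditarySubalgebra {P : Set Y} (hP : IsClopen P) {a : C(Y, ℂ)}
    (ha : IsSelfAdjoint a) (h : ∀ y ∈ P, a y ≠ 0) :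
    clopenIndicator hP ∈ hereditarySubalgebra a ha := by
  classical
  -- The witness is `a⁻²` on `P` and `0` elsewhere; adding the complementary indicator keeps the
  -- inverted function nonzero.
  refine subset_closure ⟨⟨fun y ↦ clopenIndicator hP y *
    (a y * clopenIndicator hP y + (1 - clopenIndicator hP y))⁻¹ ^ 2,
    (by fun_prop : Continuous fun y ↦ clopenIndicator hP y).mul
      ((Continuous.inv₀ (by fun_prop) fun y ↦ ?_).pow 2)⟩, ?_⟩
  · by_cases hy : y ∈ P <;> simp [clopenIndicator, hy, h y]
  · ext y
    by_cases hy : y ∈ P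
    · have := h y hy
      simp [clopenIndicator, hy]
      field_simp
    · simp [clopenIndicator, hy]

theorem norm_mul_clopenIndicator_sub_le {P : Set Y} (hP : IsClopen P) {m : C(Y, ℂ)} {ε : ℝ}
    (hε : 0 ≤ ε) (h : ∀ y ∉ P, ‖m y‖ ≤ ε) : ‖m * clopenIndicator hP - m‖ ≤ ε := by
  classical
  refine (ContinuousMap.norm_le _ hε).2 fun y ↦ ?_
  by_cases hy : y ∈ P
  · simpa [clopenIndicator, hy] using hε
  · simpa [clopenIndicator, hy] using h y hy

/-- Elements of the hereditary subalgebra are uniformly small where `a` is small, so cutting down to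
a clopen set containing `{‖a‖ ≥ 1 / (n + 1)}` changes them little. -/
theorem hasApproximateUnitOfProjections_of_isClopen {a : C(Y, ℂ)} (ha : IsSelfAdjoint a)
    (h : ∀ δ : ℝ, 0 < δ →
      ∃ P : Set Y, IsClopen P ∧ (∀ y, δ ≤ ‖a y‖ → y ∈ P) ∧ ∀ y ∈ P, a y ≠ 0) :
    HasApproximateUnitOfProjections (hereditarySubalgebra a ha) := by
  choose P hP hPδ hPa using fun n : ℕ ↦ h (1 / ((n : ℝ) + 1)) Nat.one_div_pos_of_nat
  let p : ℕ → hereditarySubalgebra a ha := fun n ↦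
    ⟨clopenIndicator (hP n), clopenIndicator_mem_hereditarySubalgebra (hP n) ha (hPa n)⟩
  have hright : ∀ m : hereditarySubalgebra a ha, Tendsto (fun n ↦ m * p n) atTop (𝓝 m) := by
    intro m
    rw [tendsto_subtype_rng, Metric.tendsto_atTop]
    intro ε hε
    obtain ⟨δ, hδ, hm⟩ := exists_norm_apply_le_of_mem_hereditarySubalgebra m.2 (half_pos hε)
    obtain ⟨N, hN⟩ := exists_nat_one_div_lt hδ
    refine ⟨N, fun n hn ↦ ?_⟩
    rw [dist_eq_norm]
    refine (norm_mul_clopenIndicator_sub_le (hP n) (half_pos hε).le fun y hy ↦ hm y ?_).trans_lt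
      (half_lt_self hε)
    by_contra! hle
    exact hy (hPδ n y ((Nat.one_div_le_one_div hn).trans (hN.le.trans hle)))
  refine ⟨map p atTop, ⟨fun m ↦ tendsto_map'_iff.2 (hright m), fun m ↦ tendsto_map'_iff.2 ?_⟩,
    eventually_map.2 (Eventually.of_forall fun n ↦ ?_)⟩
  · refine (hright m).congr fun n ↦ Subtype.ext (mul_comm _ _)
  · have := isStarProjection_clopenIndicator (hP n)
    exact ⟨Subtype.ext this.isIdempotentElem, Subtype.ext this.isSelfAdjoint⟩

variable {X : Type*} [TopologicalSpace X] [CompactSpace X]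

theorem HasNuclearDimensionZero.hasRealRankZero {φ : C(Y, X)}
    (hφ : HasNuclearDimensionZero (pullback φ)) : HasRealRankZero (pullback φ) := by
  rintro _ ⟨f, rfl⟩ ha -
  -- Positivity of `f ∘ φ` says nothing about `f` off the range of `φ`, so `f` is replaced by its
  -- modulus.
  let g : C(X, ℂ) := ⟨fun x ↦ (‖f x‖ : ℂ), by fun_prop⟩
  have hg : 0 ≤ g := fun x ↦ Complex.zero_le_real.2 (norm_nonneg _)
  refine hasApproximateUnitOfProjections_of_isClopen _ fun δ hδ ↦ ?_
  obtain ⟨P, hP, h1, h2⟩ := hφ.exists_isClopen hg hδ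
  refine ⟨P, hP, fun y hy ↦ h1 y ?_, fun y hy h0 ↦ h2 y hy ?_⟩
  · change δ ≤ ‖((‖f (φ y)‖ : ℝ) : ℂ)‖
    rwa [Complex.norm_real, norm_norm]
  · have hf0 : f (φ y) = 0 := h0
    simp [g, hf0]

/-- If `φ^*` has real rank zero, then `φ` is constant on connected components. -/
theorem HasRealRankZero.eq_of_mem_connectedComponent [T2Space X] {φ : C(Y, X)}
    (hφ : HasRealRankZero (pullback φ)) {y z : Y} (hyz : y ∈ connectedComponent z) :
    φ y = φ z := by
  by_contra hne
  obtain ⟨f, hfy, hfz, hf⟩ := exists_continuous_zero_one_of_isClosed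
    (isClosed_singleton (x := φ y)) (isClosed_singleton (x := φ z)) (by simpa using hne)
  let g : C(X, ℂ) := ⟨fun x ↦ (f x : ℂ), by fun_prop⟩
  have hgy : pullback φ g y = 0 := by
    change ((f (φ y) : ℝ) : ℂ) = 0
    rw [hfy rfl]; rfl
  have hgz : pullback φ g z = 1 := by
    change ((f (φ z) : ℝ) : ℂ) = 1
    rw [hfz rfl]; simp
  have hg : 0 ≤ pullback φ g := fun x ↦ Complex.zero_le_real.2 (hf (φ x)).1
  have hg0 : pullback φ g ≠ 0 := fun h ↦ by rw [h] at hgz; simp at hgz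
  have happrox : HasApproximateUnitOfProjections
      (hereditarySubalgebra (pullback φ g) (.of_nonneg hg)) := hφ _ ⟨g, rfl⟩ hg hg0
  generalize pullback φ g = a at *
  obtain ⟨l, hl, hlp⟩ := happrox
  have := hl.neBot
  -- `m = a²` equals `1` at `z`, so `m * p` within distance `1` of `m` contradicts `p z = 0`.
  let m : hereditarySubalgebra a (.of_nonneg hg) := ⟨a * 1 * a, subset_closure ⟨1, rfl⟩⟩
  have hev : ∀ᶠ p in l, dist (m * p) m < 1 := (hl.tendsto_mul_left m).eventually
    (Metric.ball_mem_nhds m one_pos)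
  obtain ⟨p, hpm, hp⟩ := (hev.and hlp).exists
  have hpy : (p : C(Y, ℂ)) y = 0 := apply_eq_zero_of_mem_hereditarySubalgebra p.2 hgy
  have h01 : ∀ x, (p : C(Y, ℂ)) x = 0 ∨ (p : C(Y, ℂ)) x = 1 := fun x ↦ by
    have h := congrArg (fun q : hereditarySubalgebra a (.of_nonneg hg) ↦ (q : C(Y, ℂ)) x)
      hp.isIdempotentElem.eq
    exact IsIdempotentElem.iff_eq_zero_or_one.1 h
  have hcl : IsClopen ((p : C(Y, ℂ)) ⁻¹' {0}) := by
    refine ⟨isClosed_singleton.preimage (map_continuous _), ?_⟩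
    have : (p : C(Y, ℂ)) ⁻¹' {0} = (p : C(Y, ℂ)) ⁻¹' {1}ᶜ := by
      ext x
      rcases h01 x with h | h <;> simp [h]
    rw [this]
    exact isOpen_compl_singleton.preimage (map_continuous _)
  have hpz : (p : C(Y, ℂ)) z = 0 :=
    hcl.connectedComponent_subset hpy (connectedComponent_eq hyz ▸ mem_connectedComponent)
  have h1 : ‖((m * p : hereditarySubalgebra a (.of_nonneg hg)) : C(Y, ℂ)) z
      - (m : C(Y, ℂ)) z‖ < 1 :=
    (ContinuousMap.norm_coe_le_norm ((m * p : hereditarySubalgebra a (.of_nonneg hg)) - m : C(Y, ℂ))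
      z).trans_lt (by rw [← dist_eq_norm]; exact hpm)
  simp [m, hpz, hgz] at h1

end RealRank

/-- A map `φ` that is constant on connected components factors through a profinite space. -/
theorem exists_factorization_of_eq_on_connectedComponent {X : Type u} {Y : Type v}
    [TopologicalSpace X] [CompactSpace X] [TopologicalSpace Y] [CompactSpace Y] [T2Space Y]
    {φ : C(Y, X)} (h : ∀ y z : Y, y ∈ connectedComponent z → φ y = φ z) :
    ∃ (C : Type (max v w)) (_ : NonUnitalCommCStarAlgebra C) (_ : PartialOrder C)
      (_ : StarOrderedRing C) (α : C(X, ℂ) →⋆ₙₐ[ℂ] C) (β : C →⋆ₙₐ[ℂ] C(Y, ℂ)),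
      pullback φ = β.comp α ∧ AlgebraHasNuclearDimensionZero C := by
  -- The lift only serves to land in universe `max v w`.
  let Z := ULift.{w} (ConnectedComponents Y)
  have hZ : TotallyDisconnectedSpace Z :=
    Homeomorph.ulift.symm.totallyDisconnectedSpace
  let π : C(Y, Z) := ⟨fun y ↦ ⟨y⟩, continuous_uliftUp.comp ConnectedComponents.continuous_coe⟩
  let χ : C(Z, X) := ⟨fun z ↦ Quotient.lift φ (fun y z hyz ↦ h y z
      (ConnectedComponents.coe_eq_coe'.1 (Quotient.sound hyz))) z.down,
    (φ.continuous.quotient_lift _).comp continuous_uliftDown⟩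
  exact ⟨C(Z, ℂ), inferInstance, inferInstance, inferInstance, pullback χ, pullback π, rfl,
    algebraHasNuclearDimensionZero_of_totallyDisconnected Z⟩

end RRZero

theorem mainTheorem4 {X : Type u} {Y : Type v}
    [TopologicalSpace X] [CompactSpace X] [T2Space X]
    [TopologicalSpace Y] [CompactSpace Y] [T2Space Y] (φ : C(Y, X)) :
    List.TFAE
      [RRZero.HasNuclearDimensionZero (RRZero.pullback φ),
        RRZero.HasRealRankZero (RRZero.pullback φ),
        ∃ (C : Type (max v w)) (_ : NonUnitalCommCStarAlgebra C) (_ : PartialOrder C)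
          (_ : StarOrderedRing C) (α : C(X, ℂ) →⋆ₙₐ[ℂ] C) (β : C →⋆ₙₐ[ℂ] C(Y, ℂ)),
          RRZero.pullback φ = β.comp α ∧ RRZero.AlgebraHasNuclearDimensionZero C] := by
  tfae_have 1 → 2 := fun h ↦ h.hasRealRankZero
  tfae_have 2 → 3 := fun h ↦
    RRZero.exists_factorization_of_eq_on_connectedComponent fun _ _ ↦
      h.eq_of_mem_connectedComponent
  tfae_have 3 → 1 := by
    rintro ⟨C, _, _, _, α, β, hφ, hC⟩
    rw [hφ]
    exact RRZero.HasNuclearDimensionZero.comp hC α β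
  tfae_finish
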